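/- Let $X$ be a finite alphabet and, for $x\in X^n$ and $S=\{s_1<\dots<s_k\}\subseteq[n]$, put $x_S=(x_{s_1},\dots,x_{s_k})$. For integers $0\le d\le k-1$, a $d$-$(X,k,1)$ orthogonal array is a set $T\subseteq X^k$ of size $|X|^d$ such that for every $D\subseteq[k]$ with $|D|=d$ and every $y\in X^D$ exactly one string of $T$ agrees with $y$ on $D$. Given a collection of $d$-$(X,k,1)$ orthogonal arrays $T_S$, one for each $k$-element subset $S$ of $[n]$ (no consistency between different $T_S$ is required), the orthogonal array problem is the Boolean function on $X^n$ that takes the value $1$ at $x$ iff $x_S\in T_S$ for some $k$-element $S\subseteq[n]$. The bounded-error quantum query complexity $Q_2(f)$ of $f\colon X^n\to\{0,1\}$ is the least number of queries of a quantum algorithm whose output on every $x\in X^n$ equals $f(x)$ with probability at least $2/3$. Here the state space is spanned by the basis states $|i,b,a\rangle$ with $i\in[n]$, $b\in X$ and $a$ in a finite workspace; a query is the unitary $|i,b,a\rangle\mapsto|i,b+x_i,a\rangle$, where $X$ is identified with $\mathbb{Z}/|X|\mathbb{Z}$ by a bijection that the algorithm may choose; the algorithm starts in a basis state, alternates arbitrary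 input-independent unitaries with queries, and finally measures in the basis $|i,b,a\rangle$ and outputs a function of the result. **Theorem.** For all integers $k$ and $d$ with $0\le d\le k-1$ there are a constant $c>0$ and an integer $n_0$, depending only on $k$ and $d$, such that for every $n\ge n_0$, every finite alphabet $X$ with $|X|\ge n^{k/(k-d)}$ and every collection $\{T_S\}$ of $d$-$(X,k,1)$ orthogonal arrays indexed by the $k$-element subsets $S$ of $[n]$, the orthogonal array problem of $\{T_S\}$ has bounded-error quantum query complexity at least $c\,n^{(d+1)/(d+2)}$. -/

import Mathlib

universe u

/-! ### Orthogonal arrays -/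

/-- `T ⊆ X^k` is a `d`-`(X, k, l)` orthogonal array (strength `d`, `k` factors, index `l`): it has
`l * |X|^d` elements, and for every set `D` of `d` positions and every `y ∈ X^D` exactly `l`
strings of `T` agree with `y` on `D`. -/
structure IsOrthogonalArray {X : Type u} [Fintype X] (d k l : ℕ) (T : Set (Fin k → X)) : Prop where
  card_eq : T.ncard = l * Fintype.card X ^ d
  index_eq : ∀ D : Finset (Fin k), D.card = d → ∀ y : D → X,
    {x ∈ T | ∀ i : D, x i = y i}.ncard = l

/-- The projection `x_S` of `x ∈ X^n` on a `k`-element set `S` of positions, the elements of `S`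
being listed in increasing order. -/
def proj {X : Type u} {n k : ℕ} (x : Fin n → X) (S : {S : Finset (Fin n) // S.card = k}) :
    Fin k → X :=
  fun j => x (S.1.orderEmbOfFin S.2 j)

open Classical in
/-- The orthogonal array problem of a collection `T_S ⊆ X^k`, indexed by the `k`-element sets
`S` of positions: the input `x` evaluates to 1 iff `x_S ∈ T_S` for some `S`. -/
noncomputable def orthogonalArrayProblem {X : Type u} {n k : ℕ}
    (T : {S : Finset (Fin n) // S.card = k} → Set (Fin k → X)) (x : Fin n → X) : Bool :=
  decide (∃ S : {S : Finset (Fin n) // S.card = k}, proj x S ∈ T S)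

/-! ### Quantum query algorithms -/

/-- Basis states `|i, b, a⟩`: an index `i`, an alphabet symbol `b`, a workspace symbol `a`. -/
abbrev QBasis (n : ℕ) (X : Type u) (w : ℕ) : Type u := Fin n × X × Fin w

/-- The Hilbert space spanned by the basis states. -/
abbrev QState (n : ℕ) (X : Type u) [Fintype X] (w : ℕ) : Type u :=
  EuclideanSpace ℂ (QBasis n X w)

/-- The permutation `(i, b, a) ↦ (i, b + x_i, a)` of the basis states, where symbols are added
as elements of `ℤ/|X|` through the identification `e`. -/
def queryPerm {n : ℕ} {X : Type u} [Fintype X] {w : ℕ} (e : X ≃ ZMod (Fintype.card X))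
    (x : Fin n → X) : Equiv.Perm (QBasis n X w) where
  toFun z := (z.1, e.symm (e z.2.1 + e (x z.1)), z.2.2)
  invFun z := (z.1, e.symm (e z.2.1 - e (x z.1)), z.2.2)
  left_inv z := by simp
  right_inv z := by simp

/-- The query operator `O_x |i, b, a⟩ = |i, b + x_i, a⟩`, a unitary operator. -/
noncomputable def queryOp {n : ℕ} {X : Type u} [Fintype X] {w : ℕ}
    (e : X ≃ ZMod (Fintype.card X)) (x : Fin n → X) : QState n X w ≃ₗᵢ[ℂ] QState n X w :=
  LinearIsometryEquiv.piLpCongrLeft 2 ℂ ℂ (queryPerm e x)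

/-- A quantum query algorithm on inputs from `X^n` with a Boolean output. It starts in a basis
state, applies `unitary 0`, and then `queries` times the query operator of the input followed by
the next input-independent unitary; at the end it measures in the computational basis
and outputs `out z` when the result is `z`. -/
structure QueryAlgorithm (n : ℕ) (X : Type u) [Fintype X] where
  /-- The identification of the alphabet with `ℤ/|X|` that the query operator uses. -/
  label : X ≃ ZMod (Fintype.card X)
  /-- The dimension of the workspace. -/
  workspace : ℕ
  /-- The number of queries. -/
  queries : ℕ
  /-- The initial basis state. -/
  start : QBasis n X workspace
  /-- The input-independent unitaries (those with number at most `queries` are applied). -/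
  unitary : ℕ → (QState n X workspace ≃ₗᵢ[ℂ] QState n X workspace)
  /-- The output as a function of the measurement result. -/
  out : QBasis n X workspace → Bool

namespace QueryAlgorithm

variable {n : ℕ} {X : Type u} [Fintype X]

open Classical in
/-- The state on input `x` after `t` queries (and the unitary that follows the last of them). -/
noncomputable def state (A : QueryAlgorithm n X) (x : Fin n → X) : ℕ → QState n X A.workspace
  | 0 => A.unitary 0 (EuclideanSpace.single A.start 1)
  | t + 1 => A.unitary (t + 1) (queryOp A.label x (A.state x t))

/-- The probability that the algorithm outputs `b` on input `x`. -/
noncomputable def outputProb (A : QueryAlgorithm n X) (x : Fin n → X) (b : Bool) : ℝ :=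
  ∑ z : QBasis n X A.workspace with A.out z = b, ‖A.state x A.queries z‖ ^ 2

/-- The algorithm computes `f` with bounded error: on every input the output is correct with
probability at least `2/3`. -/
def Computes (A : QueryAlgorithm n X) (f : (Fin n → X) → Bool) : Prop :=
  ∀ x, 2 / 3 ≤ A.outputProb x (f x)

end QueryAlgorithm

/-- The bounded-error quantum query complexity `Q₂(f)`: the least number of queries of a quantum
query algorithm that computes `f` with bounded error. -/
noncomputable def quantumQueryComplexity {n : ℕ} {X : Type u} [Fintype X]
    (f : (Fin n → X) → Bool) : ℕ∞ :=
  ⨅ (A : QueryAlgorithm n X) (_ : A.Computes f), (A.queries : ℕ∞)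

/-! The proof is a negative-weight adversary bound. By `QueryAlgorithm.adversary_bound`, if a matrix
between positive and negative inputs has norm at least L, and for each i its entries with x i ≠ y i
can be completed to a matrix of norm at most K, then at least L / (72 K) queries are needed.

Write q = |X|, N = n.choose k, Q = q ^ (k - d), and let Π_A (`suppProj`) be the projection onto
functions of exact support A. Rows are pairs (S, x) with x_S ∈ T_S. The block of S is the
restriction of ∑ α_S(A) Π_A, where α_S(A) = max (m - |A|) 0 if |A ∩ S| ≤ d and 0 otherwise. The
cutoff at d neutralizes the arrays: a function depending on at most d of the coordinates in S has
the same average over x_S ∈ T_S as over all x (`IsOrthogonalArray.sum_eq`). Hence in the column sums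
only A = ∅ survives, and the all-ones vector shows that the norm is at least (m / 3) √(N / Q),
provided that a ninth of all inputs are negative.

Where x i ≠ y i, the kernels of A and A ∪ {i} are opposite (`suppKernel_insert`), so for i ∉ A the
coefficient may be replaced by α_S(A) - α_S(A ∪ {i}), and for i ∈ A by 0. The difference is at most
1 unless adding i crosses the cutoff, where it is at most m. For fixed A with |A| ≤ m, at most m ^ d
* n ^ (k - d - 1) sets S are crossed, so the squared norm is O((N + m ^ (d + 2) * n ^ (k - d - 1)) /
Q). For m = ⌊n ^ ((d + 1) / (d + 2))⌋ this is O(N / Q), and L / K has order m. -/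

open scoped ComplexConjugate

/-! ### The adversary bound -/

/-- Cauchy–Schwarz in its weighted arithmetic–geometric form. The free weight `s` is what later
exploits an imbalance between row and column masses. -/
theorem norm_bilin_le {R C : Type*} [Fintype R] [Fintype C] (M : R → C → ℂ) {K : ℝ} (hK : 0 < K)
    (hM : ∀ b : C → ℂ, ∑ r, ‖∑ c, M r c * b c‖ ^ 2 ≤ K ^ 2 * ∑ c, ‖b c‖ ^ 2)
    (a : R → ℂ) (b : C → ℂ) {s : ℝ} (hs : 0 < s) :
    ‖∑ r, ∑ c, M r c * (conj (a r) * b c)‖ ≤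
      K / 2 * (s * ∑ r, ‖a r‖ ^ 2 + s⁻¹ * ∑ c, ‖b c‖ ^ 2) := by
  have h1 : ∑ r, ∑ c, M r c * (conj (a r) * b c) = ∑ r, conj (a r) * ∑ c, M r c * b c := by
    refine Finset.sum_congr rfl fun r _ => ?_
    rw [Finset.mul_sum]
    exact Finset.sum_congr rfl fun c _ => by ring
  have h2 : ∀ r, ‖conj (a r) * ∑ c, M r c * b c‖ ≤
      K / 2 * s * ‖a r‖ ^ 2 + (2 * K * s)⁻¹ * ‖∑ c, M r c * b c‖ ^ 2 := by
    intro r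
    rw [norm_mul, RCLike.norm_conj]
    generalize ‖a r‖ = x
    generalize ‖∑ c, M r c * b c‖ = y
    have : K / 2 * s * x ^ 2 + (2 * K * s)⁻¹ * y ^ 2 - x * y
        = (2 * K * s)⁻¹ * (K * s * x - y) ^ 2 := by
      field_simp
      ring
    have h0 : 0 ≤ (2 * K * s)⁻¹ * (K * s * x - y) ^ 2 := by positivity
    linarith
  rw [h1]
  calc _ ≤ ∑ r, ‖conj (a r) * ∑ c, M r c * b c‖ := norm_sum_le _ _
    _ ≤ ∑ r, (K / 2 * s * ‖a r‖ ^ 2 + (2 * K * s)⁻¹ * ‖∑ c, M r c * b c‖ ^ 2) :=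
        Finset.sum_le_sum fun r _ => h2 r
    _ = K / 2 * s * ∑ r, ‖a r‖ ^ 2 + (2 * K * s)⁻¹ * ∑ r, ‖∑ c, M r c * b c‖ ^ 2 := by
        rw [Finset.sum_add_distrib, ← Finset.mul_sum, ← Finset.mul_sum]
    _ ≤ K / 2 * s * ∑ r, ‖a r‖ ^ 2 + (2 * K * s)⁻¹ * (K ^ 2 * ∑ c, ‖b c‖ ^ 2) := by
        gcongr
        exact hM b
    _ = _ := by
        field_simp

/-- A nonzero matrix has an almost optimal unit vector for its spectral norm `G`. -/
theorem exists_almost_norming {R C : Type*} [Fintype R] [Fintype C] (M : R → C → ℂ) {L : ℝ}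
    (hL : 0 < L) (v₀ : C → ℂ)
    (h₀ : L ^ 2 * ∑ c, ‖v₀ c‖ ^ 2 ≤ ∑ r, ‖∑ c, M r c * v₀ c‖ ^ 2) (hv₀ : ∑ c, ‖v₀ c‖ ^ 2 ≠ 0) :
    ∃ G : ℝ, L ≤ G ∧ (∀ b : C → ℂ, ∑ r, ‖∑ c, M r c * b c‖ ^ 2 ≤ G ^ 2 * ∑ c, ‖b c‖ ^ 2) ∧
      ∃ v : C → ℂ, ∑ c, ‖v c‖ ^ 2 ≤ 1 ∧ (35 / 36 * G) ^ 2 ≤ ∑ r, ‖∑ c, M r c * v c‖ ^ 2 := by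
  classical
  let F : EuclideanSpace ℂ C →L[ℂ] EuclideanSpace ℂ R :=
    (Matrix.toEuclideanLin (Matrix.of M)).toContinuousLinearMap
  have hF : ∀ b : EuclideanSpace ℂ C, ‖F b‖ ^ 2 = ∑ r, ‖∑ c, M r c * b c‖ ^ 2 := by
    intro b
    rw [EuclideanSpace.norm_sq_eq]
    rfl
  have hb : ∀ b : C → ℂ, ∑ r, ‖∑ c, M r c * b c‖ ^ 2 ≤ ‖F‖ ^ 2 * ∑ c, ‖b c‖ ^ 2 := by
    intro b
    have h := F.le_opNorm (WithLp.toLp 2 b)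
    have h' := pow_le_pow_left₀ (norm_nonneg _) h 2
    rw [hF, mul_pow, EuclideanSpace.norm_sq_eq] at h'
    exact h'
  have hpos : 0 < ∑ c, ‖v₀ c‖ ^ 2 :=
    lt_of_le_of_ne (Finset.sum_nonneg fun _ _ => by positivity) (Ne.symm hv₀)
  have hLF : L ≤ ‖F‖ := by
    have := le_of_mul_le_mul_right (h₀.trans (hb v₀)) hpos
    exact le_of_sq_le_sq this (norm_nonneg _)
  refine ⟨‖F‖, hLF, hb, ?_⟩
  -- Any factor strictly between 17/18, the bound on the final progress, and 1 would do.
  obtain ⟨x, hx1, hx2⟩ := F.exists_lt_apply_of_lt_opNorm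
    (show 35 / 36 * ‖F‖ < ‖F‖ by linarith)
  refine ⟨x, ?_, ?_⟩
  · rw [← EuclideanSpace.norm_sq_eq]
    exact pow_le_one₀ (norm_nonneg _) hx1.le
  · rw [← hF]
    exact pow_le_pow_left₀ (by positivity) hx2.le 2

namespace QueryAlgorithm

variable {n : ℕ} {X : Type u} [Fintype X]

theorem norm_state (A : QueryAlgorithm n X) (x : Fin n → X) (t : ℕ) : ‖A.state x t‖ = 1 := by
  induction t with
  | zero => simp [state]
  | succ t ih => simp [state, ih]

theorem sum_norm_sq_state (A : QueryAlgorithm n X) (x : Fin n → X) (t : ℕ) :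
    ∑ z, ‖A.state x t z‖ ^ 2 = 1 := by
  rw [← EuclideanSpace.norm_sq_eq, norm_state, one_pow]

theorem outputProb_add (A : QueryAlgorithm n X) (x : Fin n → X) (b : Bool) :
    A.outputProb x b + A.outputProb x (!b) = 1 := by
  rw [← A.sum_norm_sq_state x A.queries, outputProb, outputProb,
    ← Finset.sum_filter_add_sum_filter_not Finset.univ (fun z => A.out z = b)]
  congr 1
  refine Finset.sum_congr ?_ fun _ _ => rfl
  ext z
  cases h : A.out z <;> cases b <;> simp [h]

theorem queryOp_apply {w : ℕ} (e : X ≃ ZMod (Fintype.card X)) (x : Fin n → X)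
    (ψ : QState n X w) (z : QBasis n X w) :
    queryOp e x ψ z = ψ ((queryPerm e x).symm z) := by
  rfl

theorem queryPerm_symm_congr {w : ℕ} (e : X ≃ ZMod (Fintype.card X)) {x y : Fin n → X}
    (z : QBasis n X w) (h : x z.1 = y z.1) :
    (queryPerm e x).symm z = (queryPerm e y).symm z := by
  simp [queryPerm, h]

/-- The queries at an index where two inputs agree do not change the inner product. -/
theorem sum_query_eq {w : ℕ} (e : X ≃ ZMod (Fintype.card X)) {x y : Fin n → X} (i : Fin n)
    (h : x i = y i) (ψ φ : QState n X w) :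
    ∑ p : X × Fin w, conj (queryOp e x ψ (i, p)) * queryOp e y φ (i, p) =
      ∑ p : X × Fin w, conj (ψ (i, p)) * φ (i, p) := by
  let σ : X × Fin w ≃ X × Fin w :=
    { toFun := fun p => (e.symm (e p.1 - e (x i)), p.2)
      invFun := fun p => (e.symm (e p.1 + e (x i)), p.2)
      left_inv := fun p => by simp
      right_inv := fun p => by simp }
  refine Fintype.sum_equiv σ _ _ fun p => ?_
  rw [queryOp_apply, queryOp_apply, ← queryPerm_symm_congr e (i, p) h]
  rfl

end QueryAlgorithm

theorem norm_sum_bilin_le {R C Z : Type*} [Fintype R] [Fintype C] (M : R → C → ℂ) {K : ℝ}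
    (hK : 0 < K) (hM : ∀ b : C → ℂ, ∑ r, ‖∑ c, M r c * b c‖ ^ 2 ≤ K ^ 2 * ∑ c, ‖b c‖ ^ 2)
    (u : R → ℂ) (v : C → ℂ) (φ : R → Z → ℂ) (ψ : C → Z → ℂ) (s : Finset Z) {t : ℝ} (ht : 0 < t) :
    ‖∑ r, ∑ c, M r c * (conj (u r) * v c * ∑ z ∈ s, conj (φ r z) * ψ c z)‖ ≤
      K / 2 * (t * ∑ r, ‖u r‖ ^ 2 * ∑ z ∈ s, ‖φ r z‖ ^ 2 +
        t⁻¹ * ∑ c, ‖v c‖ ^ 2 * ∑ z ∈ s, ‖ψ c z‖ ^ 2) := by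
  have h1 : ∑ r, ∑ c, M r c * (conj (u r) * v c * ∑ z ∈ s, conj (φ r z) * ψ c z) =
      ∑ z ∈ s, ∑ r, ∑ c, M r c * (conj (u r * φ r z) * (v c * ψ c z)) := by
    conv_rhs => rw [Finset.sum_comm]
    refine Finset.sum_congr rfl fun r _ => ?_
    conv_rhs => rw [Finset.sum_comm]
    refine Finset.sum_congr rfl fun c _ => ?_
    rw [Finset.mul_sum, Finset.mul_sum]
    refine Finset.sum_congr rfl fun z _ => ?_
    rw [map_mul]
    ring
  have h3 : K / 2 * (t * ∑ r, ‖u r‖ ^ 2 * ∑ z ∈ s, ‖φ r z‖ ^ 2 +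
        t⁻¹ * ∑ c, ‖v c‖ ^ 2 * ∑ z ∈ s, ‖ψ c z‖ ^ 2) = ∑ z ∈ s,
      K / 2 * (t * ∑ r, ‖u r * φ r z‖ ^ 2 + t⁻¹ * ∑ c, ‖v c * ψ c z‖ ^ 2) := by
    rw [← Finset.mul_sum, Finset.sum_add_distrib, ← Finset.mul_sum, ← Finset.mul_sum]
    congr 3
    · rw [Finset.sum_comm]
      refine Finset.sum_congr rfl fun y _ => ?_
      rw [Finset.mul_sum]
      exact Finset.sum_congr rfl fun z _ => by rw [norm_mul, mul_pow]
    · rw [Finset.sum_comm]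
      refine Finset.sum_congr rfl fun y _ => ?_
      rw [Finset.mul_sum]
      exact Finset.sum_congr rfl fun z _ => by rw [norm_mul, mul_pow]
  rw [h1, h3]
  exact (norm_sum_le _ _).trans
    (Finset.sum_le_sum fun z _ => norm_bilin_le M hK hM _ _ ht)

/-! ### The progress measure of a query algorithm -/

namespace QueryAlgorithm

variable {n : ℕ} {X : Type u} [Fintype X]

theorem sum_conj_mul_isometry {w : ℕ} (U : QState n X w ≃ₗᵢ[ℂ] QState n X w)
    (φ ψ : QState n X w) :
    ∑ z, conj (U φ z) * U ψ z = ∑ z, conj (φ z) * ψ z := by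
  have h : ∀ φ ψ : QState n X w, ∑ z, conj (φ z) * ψ z = inner ℂ φ ψ := by
    intro φ ψ
    rw [PiLp.inner_apply]
    exact Finset.sum_congr rfl fun z _ => by rw [RCLike.inner_apply, mul_comm]
  rw [h, h, U.inner_map_map]

variable {R C : Type*} [Fintype R] [Fintype C]

/-- The progress measure of an adversary matrix `M` after `t` queries. -/
noncomputable def progress (A : QueryAlgorithm n X) (p : R → Fin n → X) (q : C → Fin n → X)
    (M : R → C → ℂ) (u : R → ℂ) (v : C → ℂ) (t : ℕ) : ℂ :=
  ∑ r, ∑ c, M r c * (conj (u r) * v c *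
    ∑ z, conj (A.state (p r) t z) * A.state (q c) t z)

theorem progress_zero (A : QueryAlgorithm n X) (p : R → Fin n → X) (q : C → Fin n → X)
    (M : R → C → ℂ) (u : R → ℂ) (v : C → ℂ) :
    A.progress p q M u v 0 = ∑ r, ∑ c, M r c * (conj (u r) * v c) := by
  refine Finset.sum_congr rfl fun r _ => Finset.sum_congr rfl fun c _ => ?_
  rw [state, state, sum_conj_mul_isometry]
  simp

/-- A query acts separately on each block of basis states with fixed index i, and the masses of a
unit vector on these blocks add up to 1; so the blocks together cost one K before the query and one
K after it. -/
theorem norm_progress_succ_sub_le (A : QueryAlgorithm n X) (p : R → Fin n → X)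
    (q : C → Fin n → X) (M : R → C → ℂ) (M' : Fin n → R → C → ℂ)
    (hM : ∀ i r c, p r i ≠ q c i → M' i r c = M r c) {K : ℝ} (hK : 0 < K)
    (hM' : ∀ i, ∀ b : C → ℂ, ∑ r, ‖∑ c, M' i r c * b c‖ ^ 2 ≤ K ^ 2 * ∑ c, ‖b c‖ ^ 2)
    (u : R → ℂ) (v : C → ℂ) (hu : ∑ r, ‖u r‖ ^ 2 ≤ 1) (hv : ∑ c, ‖v c‖ ^ 2 ≤ 1) (t : ℕ) :
    ‖A.progress p q M u v (t + 1) - A.progress p q M u v t‖ ≤ 2 * K := by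
  have key : ∀ (φ : R → QState n X A.workspace) (ψ : C → QState n X A.workspace),
      (∀ r, ‖φ r‖ = 1) → (∀ c, ‖ψ c‖ = 1) →
      ‖∑ i, ∑ r, ∑ c, M' i r c *
        (conj (u r) * v c * ∑ z, conj (φ r (i, z)) * ψ c (i, z))‖ ≤ K := by
    intro φ ψ hφ hψ
    refine (norm_sum_le _ _).trans ((Finset.sum_le_sum fun i _ =>
      norm_sum_bilin_le (M' i) hK (hM' i) u v (fun r z => φ r (i, z)) (fun c z => ψ c (i, z))
        Finset.univ one_pos).trans ?_)
    have hφ' : ∑ i, ∑ r, ‖u r‖ ^ 2 * ∑ z, ‖φ r (i, z)‖ ^ 2 = ∑ r, ‖u r‖ ^ 2 := by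
      rw [Finset.sum_comm]
      refine Finset.sum_congr rfl fun y _ => ?_
      rw [← Finset.mul_sum, ← Fintype.sum_prod_type (fun z => ‖φ y z‖ ^ 2),
        ← EuclideanSpace.norm_sq_eq, hφ, one_pow, mul_one]
    have hψ' : ∑ i, ∑ r, ‖v r‖ ^ 2 * ∑ z, ‖ψ r (i, z)‖ ^ 2 = ∑ r, ‖v r‖ ^ 2 := by
      rw [Finset.sum_comm]
      refine Finset.sum_congr rfl fun y _ => ?_
      rw [← Finset.mul_sum, ← Fintype.sum_prod_type (fun z => ‖ψ y z‖ ^ 2),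
        ← EuclideanSpace.norm_sq_eq, hψ, one_pow, mul_one]
    rw [← Finset.mul_sum, Finset.sum_add_distrib, ← Finset.mul_sum, ← Finset.mul_sum, hφ', hψ',
      inv_one, one_mul, one_mul]
    nlinarith
  let φ' : R → QState n X A.workspace := fun r => queryOp A.label (p r) (A.state (p r) t)
  let ψ' : C → QState n X A.workspace := fun c => queryOp A.label (q c) (A.state (q c) t)
  have hsplit : A.progress p q M u v (t + 1) - A.progress p q M u v t =
      (∑ i, ∑ r, ∑ c, M' i r c *
        (conj (u r) * v c * ∑ z, conj (φ' r (i, z)) * ψ' c (i, z))) -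
      ∑ i, ∑ r, ∑ c, M' i r c * (conj (u r) * v c *
        ∑ z, conj (A.state (p r) t (i, z)) * A.state (q c) t (i, z)) := by
    rw [progress, progress, ← Finset.sum_sub_distrib, ← Finset.sum_sub_distrib]
    simp_rw [← Finset.sum_sub_distrib]
    conv_rhs => rw [Finset.sum_comm]
    refine Finset.sum_congr rfl fun r _ => ?_
    conv_rhs => rw [Finset.sum_comm]
    refine Finset.sum_congr rfl fun c _ => ?_
    rw [state, state, sum_conj_mul_isometry, Fintype.sum_prod_type, Fintype.sum_prod_type,
      ← mul_sub, ← mul_sub, ← Finset.sum_sub_distrib, Finset.mul_sum, Finset.mul_sum]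
    refine Finset.sum_congr rfl fun i _ => ?_
    -- If the inputs agree at i, the block contributes nothing whatever `M'` is there; this is the
    -- freedom in choosing `M'`.
    by_cases h : p r i = q c i
    · have := sum_query_eq A.label i h (A.state (p r) t) (A.state (q c) t)
      simp only [φ', ψ', this, sub_self, mul_zero]
    · rw [hM i r c h]
      simp only [φ', ψ']
      ring
  rw [hsplit]
  refine (norm_sub_le _ _).trans ?_
  have h1 := key φ' ψ' (fun r => by simp [φ', norm_state]) (fun c => by simp [ψ', norm_state])
  have h2 := key (fun r => A.state (p r) t) (fun c => A.state (q c) t)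
    (fun r => A.norm_state _ _) (fun c => A.norm_state _ _)
  linarith

/-- Final states of rows lie mostly on outputs `true`, those of columns on outputs `false`.
Weighting each half against its heavier side gains a constant factor: 3/4 · 2/3 + 4/3 · 1/3 = 17/18.
The weight 3/4 approximates the optimal 1/√2. -/
theorem norm_progress_queries_le (A : QueryAlgorithm n X) {f : (Fin n → X) → Bool}
    (hA : A.Computes f) (p : R → Fin n → X) (q : C → Fin n → X)
    (hp : ∀ r, f (p r) = true) (hq : ∀ c, f (q c) = false) (M : R → C → ℂ) {G : ℝ} (hG : 0 < G)
    (hM : ∀ b : C → ℂ, ∑ r, ‖∑ c, M r c * b c‖ ^ 2 ≤ G ^ 2 * ∑ c, ‖b c‖ ^ 2)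
    (u : R → ℂ) (v : C → ℂ) (hu : ∑ r, ‖u r‖ ^ 2 ≤ 1) (hv : ∑ c, ‖v c‖ ^ 2 ≤ 1) :
    ‖A.progress p q M u v A.queries‖ ≤ 17 / 18 * G := by
  have hsplit : A.progress p q M u v A.queries =
      (∑ r, ∑ c, M r c * (conj (u r) * v c * ∑ z with A.out z = true,
        conj (A.state (p r) A.queries z) * A.state (q c) A.queries z)) +
      ∑ r, ∑ c, M r c * (conj (u r) * v c * ∑ z with A.out z = false,
        conj (A.state (p r) A.queries z) * A.state (q c) A.queries z) := by
    rw [progress, ← Finset.sum_add_distrib]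
    refine Finset.sum_congr rfl fun r _ => ?_
    rw [← Finset.sum_add_distrib]
    refine Finset.sum_congr rfl fun c _ => ?_
    rw [← mul_add, ← mul_add,
      ← Finset.sum_filter_add_sum_filter_not Finset.univ (fun z => A.out z = true)]
    simp only [Bool.not_eq_true]
  have hT := norm_sum_bilin_le M hG hM u v (fun r => A.state (p r) A.queries)
    (fun c => A.state (q c) A.queries) (Finset.univ.filter fun z => A.out z = true)
    (show (0 : ℝ) < 3 / 4 by norm_num)
  have hF := norm_sum_bilin_le M hG hM u v (fun r => A.state (p r) A.queries)
    (fun c => A.state (q c) A.queries) (Finset.univ.filter fun z => A.out z = false)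
    (show (0 : ℝ) < 4 / 3 by norm_num)
  have hrow : 3 / 4 * ∑ r, ‖u r‖ ^ 2 * A.outputProb (p r) true +
      4 / 3 * ∑ r, ‖u r‖ ^ 2 * A.outputProb (p r) false ≤ 17 / 18 * ∑ r, ‖u r‖ ^ 2 := by
    rw [Finset.mul_sum, Finset.mul_sum, Finset.mul_sum, ← Finset.sum_add_distrib]
    refine Finset.sum_le_sum fun r _ => ?_
    have h1 := hA (p r)
    rw [hp r] at h1
    have h2 := A.outputProb_add (p r) true
    rw [Bool.not_true] at h2
    nlinarith [sq_nonneg ‖u r‖]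
  have hcol : 4 / 3 * ∑ c, ‖v c‖ ^ 2 * A.outputProb (q c) true +
      3 / 4 * ∑ c, ‖v c‖ ^ 2 * A.outputProb (q c) false ≤ 17 / 18 * ∑ c, ‖v c‖ ^ 2 := by
    rw [Finset.mul_sum, Finset.mul_sum, Finset.mul_sum, ← Finset.sum_add_distrib]
    refine Finset.sum_le_sum fun c _ => ?_
    have h1 := hA (q c)
    rw [hq c] at h1
    have h2 := A.outputProb_add (q c) true
    rw [Bool.not_true] at h2
    nlinarith [sq_nonneg ‖v c‖]
  have e1 : (3 / 4 : ℝ)⁻¹ = 4 / 3 := by norm_num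
  have e2 : (4 / 3 : ℝ)⁻¹ = 3 / 4 := by norm_num
  rw [e1] at hT
  rw [e2] at hF
  rw [hsplit]
  refine (norm_add_le _ _).trans ((add_le_add hT hF).trans ?_)
  unfold outputProb at hrow hcol
  rw [← mul_add]
  have : G / 2 * (17 / 18 + 17 / 18) = 17 / 18 * G := by ring
  rw [← this]
  refine mul_le_mul_of_nonneg_left ?_ (by positivity)
  linarith

/-- The negative-weight adversary bound for an adversary matrix `M` of norm at least `L`, such that
for each index `i` some matrix of norm at most `K` agrees with `M` on the pairs of inputs that
differ at `i`. -/
theorem adversary_bound (A : QueryAlgorithm n X) {f : (Fin n → X) → Bool}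
    (hA : A.Computes f) (p : R → Fin n → X) (q : C → Fin n → X)
    (hp : ∀ r, f (p r) = true) (hq : ∀ c, f (q c) = false) (M : R → C → ℂ)
    (M' : Fin n → R → C → ℂ) (hM : ∀ i r c, p r i ≠ q c i → M' i r c = M r c) {K L : ℝ}
    (hK : 0 < K) (hL : 0 < L)
    (hM' : ∀ i, ∀ b : C → ℂ, ∑ r, ‖∑ c, M' i r c * b c‖ ^ 2 ≤ K ^ 2 * ∑ c, ‖b c‖ ^ 2)
    (v₀ : C → ℂ) (h₀ : L ^ 2 * ∑ c, ‖v₀ c‖ ^ 2 ≤ ∑ r, ‖∑ c, M r c * v₀ c‖ ^ 2)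
    (hv₀ : ∑ c, ‖v₀ c‖ ^ 2 ≠ 0) :
    L ≤ 72 * K * A.queries := by
  obtain ⟨G, hLG, hG, v, hv, hvG⟩ := exists_almost_norming M hL v₀ h₀ hv₀
  have hG0 : 0 < G := hL.trans_le hLG
  set a : R → ℂ := fun r => ∑ c, M r c * v c with ha
  set N : ℝ := √(∑ r, ‖a r‖ ^ 2) with hN
  have hNsq : N ^ 2 = ∑ r, ‖a r‖ ^ 2 := Real.sq_sqrt (Finset.sum_nonneg fun _ _ => by positivity)
  have hNG : 35 / 36 * G ≤ N := Real.le_sqrt_of_sq_le hvG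
  have hN0 : 0 < N := by linarith
  let u : R → ℂ := fun r => (N : ℂ)⁻¹ * a r
  have hu : ∑ r, ‖u r‖ ^ 2 ≤ 1 := by
    simp only [u, norm_mul, mul_pow, ← Finset.mul_sum, ← hNsq]
    rw [norm_inv, Complex.norm_real, Real.norm_of_nonneg hN0.le, ← mul_pow,
      inv_mul_cancel₀ hN0.ne', one_pow]
  have hW0 : A.progress p q M u v 0 = (N : ℂ) := by
    have h1 : A.progress p q M u v 0 = ∑ r, conj (u r) * a r := by
      rw [progress_zero]
      refine Finset.sum_congr rfl fun r _ => ?_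
      rw [ha, Finset.mul_sum]
      exact Finset.sum_congr rfl fun c _ => by ring
    have h2 : ∀ r, conj (u r) * a r = (N : ℂ)⁻¹ * ((‖a r‖ ^ 2 : ℝ) : ℂ) := by
      intro r
      simp only [u, map_mul, map_inv₀, Complex.conj_ofReal]
      rw [mul_assoc, mul_comm (conj (a r)), Complex.mul_conj, Complex.normSq_eq_norm_sq]
    rw [h1, Finset.sum_congr rfl fun r _ => h2 r, ← Finset.mul_sum, ← Complex.ofReal_sum, ← hNsq]
    have : (N : ℂ) ≠ 0 := Complex.ofReal_ne_zero.mpr hN0.ne'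
    push_cast
    field_simp
  have hstep : ∀ t : ℕ, N - 2 * K * t ≤ ‖A.progress p q M u v t‖ := by
    intro t
    induction t with
    | zero =>
      rw [hW0, Complex.norm_real, Real.norm_of_nonneg hN0.le]
      simp
    | succ t ih =>
      have h1 := A.norm_progress_succ_sub_le p q M M' hM hK hM' u v hu hv t
      have h2 := norm_sub_norm_le (A.progress p q M u v t) (A.progress p q M u v (t + 1))
      rw [norm_sub_rev] at h2
      push_cast
      linarith
  -- With T queries, 35/36 · G - 2KT ≤ 17/18 · G, that is, G ≤ 72KT.
  have h1 := hstep A.queries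
  have h2 := A.norm_progress_queries_le hA p q hp hq M hG0 hG u v hu hv
  linarith

end QueryAlgorithm

/-! ### The projections onto functions of exact support -/

theorem sum_pi_prod {ι X M : Type*} [Fintype ι] [DecidableEq ι] [Fintype X] [CommSemiring M]
    (f : ι → X → M) : ∑ x : ι → X, ∏ j, f j (x j) = ∏ j, ∑ a, f j a := by
  rw [Finset.prod_univ_sum, Fintype.piFinset_univ]

section FourierKernel

variable {ι X : Type*} [Fintype ι] [DecidableEq ι] [Fintype X] [DecidableEq X]

/-- The kernel of the orthogonal projection of the functions on `X^ι` onto those that depend on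
the coordinates in `A` only and have zero sum in each of them. -/
noncomputable def suppKernel (A : Finset ι) (x y : ι → X) : ℂ :=
  ∏ j, if j ∈ A then (if x j = y j then 1 else 0) - (Fintype.card X : ℂ)⁻¹
    else (Fintype.card X : ℂ)⁻¹

theorem conj_suppKernel (A : Finset ι) (x y : ι → X) :
    conj (suppKernel A x y) = suppKernel A x y := by
  rw [suppKernel, map_prod]
  refine Finset.prod_congr rfl fun j _ => ?_
  split_ifs <;> simp

theorem suppKernel_congr {A : Finset ι} {x x' : ι → X} (y : ι → X) (h : ∀ j ∈ A, x j = x' j) :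
    suppKernel A x y = suppKernel A x' y := by
  refine Finset.prod_congr rfl fun j _ => ?_
  split_ifs with h1 h2 h3 h3
  all_goals first | rfl | (rw [h j h1] at h2; contradiction)

/-- With J the all-ones matrix, the factors at i are I - J/q and J/q, whose off-diagonal entries are
opposite. -/
theorem suppKernel_insert {A : Finset ι} {i : ι} (hi : i ∉ A) {x y : ι → X} (h : x i ≠ y i) :
    suppKernel (insert i A) x y = -suppKernel A x y := by
  rw [suppKernel, suppKernel, ← Finset.mul_prod_erase _ _ (Finset.mem_univ i),
    ← Finset.mul_prod_erase _ _ (Finset.mem_univ i), if_pos (Finset.mem_insert_self _ _),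
    if_neg h, if_neg hi, zero_sub, neg_mul]
  congr 2
  refine Finset.prod_congr rfl fun j hj => ?_
  simp [Finset.mem_insert, Finset.ne_of_mem_erase hj]

theorem sum_suppKernel [Nonempty X] (A : Finset ι) (y : ι → X) :
    ∑ x, suppKernel A x y = if A = ∅ then 1 else 0 := by
  have hq : (Fintype.card X : ℂ) ≠ 0 := Nat.cast_ne_zero.mpr Fintype.card_ne_zero
  have h := sum_pi_prod fun j a => if j ∈ A then (if a = y j then 1 else 0) -
    (Fintype.card X : ℂ)⁻¹ else (Fintype.card X : ℂ)⁻¹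
  refine h.trans ?_
  split_ifs with hA
  · subst hA
    simp [hq]
  · obtain ⟨j, hj⟩ := Finset.nonempty_iff_ne_empty.mpr hA
    exact Finset.prod_eq_zero (Finset.mem_univ j) (by simp [hj, hq])

/-- The kernels are tensor products of the complementary symmetric projections J/q and I - J/q, so
distinct ones annihilate each other in some coordinate. -/
theorem sum_suppKernel_mul [Nonempty X] (A B : Finset ι) (y z : ι → X) :
    ∑ x, suppKernel A x y * suppKernel B x z = if A = B then suppKernel A y z else 0 := by
  have hq : (Fintype.card X : ℂ) ≠ 0 := Nat.cast_ne_zero.mpr Fintype.card_ne_zero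
  have h := sum_pi_prod fun j a => (if j ∈ A then (if a = y j then 1 else 0) -
    (Fintype.card X : ℂ)⁻¹ else (Fintype.card X : ℂ)⁻¹) * (if j ∈ B then (if a = z j then 1 else 0) -
    (Fintype.card X : ℂ)⁻¹ else (Fintype.card X : ℂ)⁻¹)
  have h' : ∑ x, suppKernel A x y * suppKernel B x z = _ :=
    (Finset.sum_congr rfl fun x _ => Finset.prod_mul_distrib.symm).trans h
  rw [h']
  split_ifs with hAB
  · subst hAB
    refine Finset.prod_congr rfl fun j _ => ?_
    split_ifs with h1 h2
    · simp [h2, sub_mul, mul_sub, hq]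
    · simp [sub_mul, mul_sub, hq, Ne.symm h2]
    · simp [hq]
  · have : ∃ j, ¬ (j ∈ A ↔ j ∈ B) := by
      by_contra! hc
      exact hAB (Finset.ext hc)
    obtain ⟨j, hj⟩ := this
    refine Finset.prod_eq_zero (Finset.mem_univ j) ?_
    by_cases h1 : j ∈ A <;> by_cases h2 : j ∈ B
    · tauto
    · simp [h1, h2, ← Finset.sum_mul, hq]
    · simp [h1, h2, ← Finset.mul_sum, hq]
    · tauto

theorem sum_finset_suppKernel (x y : ι → X) :
    ∑ A, suppKernel A x y = if x = y then 1 else 0 := by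
  have h := Finset.prod_add (fun j => (if x j = y j then 1 else 0) - (Fintype.card X : ℂ)⁻¹)
    (fun _ => (Fintype.card X : ℂ)⁻¹) (Finset.univ : Finset ι)
  have h' : ∑ A, suppKernel A x y =
      ∏ j, ((if x j = y j then 1 else 0) - (Fintype.card X : ℂ)⁻¹ + (Fintype.card X : ℂ)⁻¹) := by
    rw [h, Finset.powerset_univ]
    refine Finset.sum_congr rfl fun A _ => ?_
    rw [suppKernel, Finset.prod_ite]
    congr 1
    · exact Finset.prod_congr (by ext; simp) fun _ _ => rfl
    · exact Finset.prod_congr (by ext; simp) fun _ _ => rfl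
  rw [h']
  simp only [sub_add_cancel, Finset.prod_ite_zero, Finset.prod_const_one, Finset.mem_univ,
    true_implies, funext_iff]

/-- The orthogonal projection with kernel `suppKernel A`. -/
noncomputable def suppProj (A : Finset ι) (b : (ι → X) → ℂ) (x : ι → X) : ℂ :=
  ∑ y, suppKernel A x y * b y

theorem suppProj_congr {A : Finset ι} {x x' : ι → X} (b : (ι → X) → ℂ)
    (h : ∀ j ∈ A, x j = x' j) : suppProj A b x = suppProj A b x' :=
  Finset.sum_congr rfl fun y _ => by rw [suppKernel_congr y h]

theorem sum_suppProj (b : (ι → X) → ℂ) (x : ι → X) : ∑ A, suppProj A b x = b x := by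
  simp only [suppProj]
  rw [Finset.sum_comm]
  simp [← Finset.sum_mul, sum_finset_suppKernel]

theorem sum_conj_suppProj_mul [Nonempty X] {A B : Finset ι} (hAB : A ≠ B) (b : (ι → X) → ℂ) :
    ∑ x, conj (suppProj A b x) * suppProj B b x = 0 := by
  have h : ∀ x, conj (suppProj A b x) * suppProj B b x =
      ∑ y, ∑ z, conj (b y) * b z * (suppKernel A x y * suppKernel B x z) := by
    intro x
    rw [suppProj, suppProj, map_sum, Finset.sum_mul_sum]
    refine Finset.sum_congr rfl fun y _ => Finset.sum_congr rfl fun z _ => ?_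
    rw [map_mul, conj_suppKernel]
    ring
  rw [Finset.sum_congr rfl fun x _ => h x, Finset.sum_comm]
  refine Finset.sum_eq_zero fun y _ => ?_
  rw [Finset.sum_comm]
  refine Finset.sum_eq_zero fun z _ => ?_
  rw [← Finset.mul_sum, sum_suppKernel_mul, if_neg hAB, mul_zero]

theorem sum_norm_sq_sum_suppProj [Nonempty X] (s : Finset (Finset ι)) (γ : Finset ι → ℂ)
    (b : (ι → X) → ℂ) :
    ∑ x, ‖∑ A ∈ s, γ A * suppProj A b x‖ ^ 2 =
      ∑ A ∈ s, ‖γ A‖ ^ 2 * ∑ x, ‖suppProj A b x‖ ^ 2 := by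
  apply Complex.ofReal_injective
  push_cast
  simp only [← Complex.conj_mul']
  have h : ∀ x, conj (∑ A ∈ s, γ A * suppProj A b x) * ∑ A ∈ s, γ A * suppProj A b x =
      ∑ A ∈ s, ∑ B ∈ s, conj (γ A) * γ B * (conj (suppProj A b x) * suppProj B b x) := by
    intro x
    rw [map_sum, Finset.sum_mul_sum]
    refine Finset.sum_congr rfl fun y _ => Finset.sum_congr rfl fun z _ => ?_
    rw [map_mul]
    ring
  rw [Finset.sum_congr rfl fun x _ => h x, Finset.sum_comm]
  refine Finset.sum_congr rfl fun A hA => ?_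
  rw [Finset.sum_comm, Finset.sum_eq_single_of_mem A hA]
  · rw [Finset.mul_sum]
  · intro B _ hB
    rw [← Finset.mul_sum, sum_conj_suppProj_mul hB.symm, mul_zero]

theorem sum_norm_sq_suppProj [Nonempty X] (b : (ι → X) → ℂ) :
    ∑ A, ∑ x, ‖suppProj A b x‖ ^ 2 = ∑ x, ‖b x‖ ^ 2 := by
  have h := sum_norm_sq_sum_suppProj Finset.univ (fun _ => 1) b
  simp only [one_mul, sum_suppProj, norm_one, one_pow] at h
  exact h.symm

end FourierKernel

/-! ### Sums over orthogonal arrays -/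

theorem card_agree_off {ι X : Type*} [Fintype ι] [DecidableEq ι] [Fintype X] [DecidableEq X]
    (E : Finset ι) (x : ι → X) :
    (Finset.univ.filter fun y : ι → X => ∀ j ∉ E, y j = x j).card = Fintype.card X ^ E.card := by
  have h : (Finset.univ.filter fun y : ι → X => ∀ j ∉ E, y j = x j) =
      Fintype.piFinset fun j => if j ∈ E then Finset.univ else {x j} := by
    ext y
    simp only [Finset.mem_filter, Finset.mem_univ, true_and, Fintype.mem_piFinset]
    refine forall_congr' fun j => ?_
    split_ifs with hj <;> simp [hj]
  rw [h, Fintype.card_piFinset]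
  have h2 : ∀ j, (if j ∈ E then (Finset.univ : Finset X) else {x j}).card =
      if j ∈ E then Fintype.card X else 1 := by
    intro j
    split_ifs <;> simp
  simp [h2]

section OrthogonalArray

variable {X : Type u} [Fintype X] {n k d : ℕ} {T : Set (Fin k → X)}
  (S : {S : Finset (Fin n) // S.card = k})

/-- An orthogonal array on the positions `S` contains exactly one string that agrees with a given
one off `S \ D`, if `D` has as many elements as the strength. -/
theorem IsOrthogonalArray.existsUnique (hT : IsOrthogonalArray d k 1 T) {D : Finset (Fin n)}
    (hDS : D ⊆ S.1) (hD : D.card = d) (x : Fin n → X) :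
    ∃! x' : Fin n → X, proj x' S ∈ T ∧ ∀ j ∉ S.1 \ D, x j = x' j := by
  classical
  let o := S.1.orderIsoOfFin S.2
  have ho : ∀ j, S.1.orderEmbOfFin S.2 j = (o j : Fin n) := fun j => rfl
  let D' : Finset (Fin k) := Finset.univ.filter fun j => (o j : Fin n) ∈ D
  have hD' : D'.card = d := by
    rw [← hD]
    refine Finset.card_bij (fun j _ => (o j : Fin n)) (fun j hj => (Finset.mem_filter.mp hj).2)
      (fun a _ b _ hab => o.injective (Subtype.ext hab)) fun b hb => ?_
    exact ⟨o.symm ⟨b, hDS hb⟩, by simp [D', hb], by simp⟩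
  obtain ⟨w, hw⟩ := Set.ncard_eq_one.mp (hT.index_eq D' hD' fun i => x (o i))
  have hw1 : w ∈ T ∧ ∀ i : D', w i = x (o i) := by
    have : w ∈ ({w} : Set (Fin k → X)) := rfl
    rwa [← hw] at this
  refine ⟨fun j => if h : j ∈ S.1 then w (o.symm ⟨j, h⟩) else x j, ⟨?_, ?_⟩, ?_⟩
  · have : proj (fun j => if h : j ∈ S.1 then w (o.symm ⟨j, h⟩) else x j) S = w := by
      funext j
      simp only [proj, ho]
      rw [dif_pos (o j).2]
      simp
    rw [this]
    exact hw1.1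
  · intro j hj
    by_cases h : j ∈ S.1
    · have hjD : j ∈ D := by
        by_contra hc
        exact hj (Finset.mem_sdiff.mpr ⟨h, hc⟩)
      have := hw1.2 ⟨o.symm ⟨j, h⟩, by simp [D', hjD]⟩
      simp only [dif_pos h, this, OrderIso.apply_symm_apply]
    · simp only [dif_neg h]
  · rintro y ⟨hy, hyx⟩
    have hyw : proj y S = w := by
      have : proj y S ∈ ({w} : Set (Fin k → X)) := by
        rw [← hw]
        refine ⟨hy, fun i => ?_⟩
        have hi : (o i : Fin n) ∈ D := (Finset.mem_filter.mp i.2).2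
        rw [hyx (o i) (by simp [hi])]
        rfl
      exact this
    funext j
    by_cases h : j ∈ S.1
    · simp only [dif_pos h, ← hyw, proj, ho, OrderIso.apply_symm_apply]
    · simp only [dif_neg h]
      exact (hyx j fun hj => h (Finset.mem_sdiff.mp hj).1).symm

open Classical in
-- Double counting of the pairs (x, x') with x' in the array that agree off S \ D: each x has
-- exactly one partner, each x' has |X| ^ (k - d).
theorem IsOrthogonalArray.sum_eq {M : Type*} [CommSemiring M] (hT : IsOrthogonalArray d k 1 T)
    {D : Finset (Fin n)} (hDS : D ⊆ S.1) (hD : D.card = d) (h : (Fin n → X) → M)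
    (hh : ∀ x x', (∀ j ∉ S.1 \ D, x j = x' j) → h x = h x') :
    (Fintype.card X : M) ^ (k - d) * ∑ x with proj x S ∈ T, h x = ∑ x, h x := by
  have h1 : ∀ x, h x =
      ∑ x' with proj x' S ∈ T, if ∀ j ∉ S.1 \ D, x j = x' j then h x' else 0 := by
    intro x
    obtain ⟨x₀, ⟨h2, h3⟩, h4⟩ := hT.existsUnique S hDS hD x
    rw [Finset.sum_eq_single_of_mem x₀ (by simpa using h2), if_pos h3, hh x x₀ h3]
    intro y hy hy'
    refine if_neg fun hc => hy' (h4 y ⟨by simpa using hy, hc⟩)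
  have hcard : (S.1 \ D).card = k - d := by
    rw [Finset.card_sdiff_of_subset hDS, S.2, hD]
  have h2 : ∑ x, h x = ∑ x : Fin n → X,
      ∑ x' with proj x' S ∈ T, if ∀ j ∉ S.1 \ D, x j = x' j then h x' else 0 :=
    Finset.sum_congr rfl fun x _ => h1 x
  rw [h2, Finset.sum_comm, Finset.mul_sum]
  refine Finset.sum_congr rfl fun x' _ => ?_
  have hc : (Finset.univ.filter fun a : Fin n → X => ∀ j ∉ S.1 \ D, a j = x' j).card =
      Fintype.card X ^ (k - d) := by
    rw [← hcard]
    convert card_agree_off (S.1 \ D) x'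
  rw [← Finset.sum_filter, Finset.sum_const, hc, nsmul_eq_mul, Nat.cast_pow]

end OrthogonalArray

/-! ### The adversary matrix -/

theorem sum_insert_eq {ι M : Type*} [Fintype ι] [DecidableEq ι] [AddCommMonoid M]
    (g : Finset ι → M) (i : ι) :
    ∑ A, g A = ∑ A, if i ∈ A then 0 else g A + g (insert i A) := by
  have h := Finset.sum_powerset_insert (Finset.notMem_erase i Finset.univ) g
  rw [Finset.insert_erase (Finset.mem_univ i), Finset.powerset_univ, ← Finset.sum_add_distrib] at h
  rw [h]
  simp_rw [← ite_not (_ ∈ _)]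
  rw [← Finset.sum_filter]
  refine Finset.sum_congr ?_ fun _ _ => rfl
  ext A
  simp only [Finset.mem_powerset, Finset.mem_filter, Finset.mem_univ, true_and]
  exact ⟨fun hA hi => Finset.notMem_erase i _ (hA hi), fun hA j hj =>
    Finset.mem_erase.mpr ⟨fun e => hA (e ▸ hj), Finset.mem_univ j⟩⟩

/-- The coefficients of the adversary matrix for the set `S` of positions. -/
noncomputable def advCoeff {n : ℕ} (d m : ℕ) (S A : Finset (Fin n)) : ℂ :=
  if (A ∩ S).card ≤ d then ((m - A.card : ℕ) : ℂ) else 0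

/-- The coefficients of the adversary matrix after the projections that involve the coordinate `i`
have been replaced by the opposite of the ones that do not. -/
noncomputable def advCoeffDiff {n : ℕ} (d m : ℕ) (i : Fin n) (S A : Finset (Fin n)) : ℂ :=
  if i ∈ A then 0 else advCoeff d m S A - advCoeff d m S (insert i A)

/-! ### Size of the difference coefficients -/

section Coefficients

variable {n d m : ℕ}

theorem advCoeff_of_lt {S A : Finset (Fin n)} (h : d < (A ∩ S).card) : advCoeff d m S A = 0 :=
  if_neg (not_le.mpr h)

theorem advCoeffDiff_of_lt (i : Fin n) {S A : Finset (Fin n)} (h : d < (A ∩ S).card) :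
    advCoeffDiff d m i S A = 0 := by
  have h' : d < (insert i A ∩ S).card :=
    h.trans_le (Finset.card_le_card (Finset.inter_subset_inter_right (Finset.subset_insert i A)))
  rw [advCoeffDiff, advCoeff_of_lt h, advCoeff_of_lt h', sub_zero, ite_self]

theorem norm_advCoeffDiff_sq_le (i : Fin n) (S A : Finset (Fin n)) :
    ‖advCoeffDiff d m i S A‖ ^ 2 ≤
      1 + if i ∉ A ∧ A.card ≤ m ∧ i ∈ S ∧ (A ∩ S).card = d then (m : ℝ) ^ 2 else 0 := by
  have hite : (0 : ℝ) ≤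
      if i ∉ A ∧ A.card ≤ m ∧ i ∈ S ∧ (A ∩ S).card = d then (m : ℝ) ^ 2 else 0 := by
    split_ifs <;> positivity
  by_cases hi : i ∈ A
  · rw [advCoeffDiff, if_pos hi]
    simpa using by linarith
  rcases lt_or_ge d (A ∩ S).card with hlt | hle
  · rw [advCoeffDiff_of_lt i hlt]
    simpa using by linarith
  have hstep : ‖((m - A.card : ℕ) : ℂ) - ((m - (A.card + 1) : ℕ) : ℂ)‖ ≤ 1 := by
    rcases lt_or_ge A.card m with h | h
    · have : m - A.card = m - (A.card + 1) + 1 := by omega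
      rw [this]
      simp
    · have e1 : m - A.card = 0 := by omega
      have e2 : m - (A.card + 1) = 0 := by omega
      simp [e1, e2]
  rw [advCoeffDiff, if_neg hi, advCoeff, advCoeff, if_pos hle, Finset.card_insert_of_notMem hi]
  split_ifs with h1 h2 h2
  · have := pow_le_one₀ (n := 2) (norm_nonneg _) hstep
    nlinarith [sq_nonneg (m : ℝ)]
  · have := pow_le_one₀ (n := 2) (norm_nonneg _) hstep
    linarith
  · rw [sub_zero, Complex.norm_natCast]
    have : ((m - A.card : ℕ) : ℝ) ≤ m := by exact_mod_cast Nat.sub_le _ _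
    have := pow_le_pow_left₀ (Nat.cast_nonneg _) this 2
    linarith
  -- The cutoff is crossed but the indicator vanishes: then |A| > m, and the truncated subtraction
  -- already gives 0.
  · have hS : i ∈ S := by
      by_contra hS
      rw [Finset.insert_inter_of_notMem hS] at h1
      exact h1 hle
    have hd : (A ∩ S).card = d := by
      rw [Finset.insert_inter_of_mem hS, Finset.card_insert_of_notMem (by simp [hi])] at h1
      omega
    have : m - A.card = 0 := by
      by_contra hc
      exact h2 ⟨hi, by omega, hS, hd⟩
    simp [this]

/-- Such an S consists of i, a d-subset of A, and k - d - 1 further positions. -/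
theorem card_crossing_le {k : ℕ} (i : Fin n) (A : Finset (Fin n)) :
    (Finset.univ.filter fun S : {S : Finset (Fin n) // S.card = k} =>
      i ∉ A ∧ A.card ≤ m ∧ i ∈ S.1 ∧ (A ∩ S.1).card = d).card ≤ m ^ d * n ^ (k - d - 1) := by
  by_cases hA : i ∉ A ∧ A.card ≤ m
  swap
  · rw [Finset.filter_false_of_mem fun S _ hS => hA ⟨hS.1, hS.2.1⟩]
    simp
  obtain ⟨hiA, hAm⟩ := hA
  have h1 : (Finset.univ.filter fun S : {S : Finset (Fin n) // S.card = k} =>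
      i ∉ A ∧ A.card ≤ m ∧ i ∈ S.1 ∧ (A ∩ S.1).card = d).card ≤
      (A.powersetCard d ×ˢ (Finset.univ : Finset (Fin n)).powersetCard (k - d - 1)).card := by
    refine Finset.card_le_card_of_injOn (fun S => (A ∩ S.1, (S.1 \ A).erase i)) ?_ ?_
    · intro S hS
      obtain ⟨-, -, hiS, hd⟩ := (Finset.mem_filter.mp hS).2
      have h2 : (S.1 \ A).card = k - d := by
        rw [Finset.card_sdiff, S.2, hd]
      refine Finset.mem_product.mpr ⟨Finset.mem_powersetCard.mpr ⟨Finset.inter_subset_left, hd⟩,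
        Finset.mem_powersetCard.mpr ⟨Finset.subset_univ _, ?_⟩⟩
      rw [Finset.card_erase_of_mem (Finset.mem_sdiff.mpr ⟨hiS, hiA⟩), h2]
    · intro S hS S' hS' he
      have hr : ∀ U : Finset (Fin n), i ∈ U → U = (A ∩ U) ∪ insert i ((U \ A).erase i) := by
        intro U hU
        rw [Finset.insert_erase (Finset.mem_sdiff.mpr ⟨hU, hiA⟩)]
        ext j
        simp only [Finset.mem_union, Finset.mem_inter, Finset.mem_sdiff]
        tauto
      have e1 : A ∩ S.1 = A ∩ S'.1 := congrArg Prod.fst he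
      have e2 : (S.1 \ A).erase i = (S'.1 \ A).erase i := congrArg Prod.snd he
      apply Subtype.ext
      rw [hr S.1 (Finset.mem_filter.mp hS).2.2.2.1, hr S'.1 (Finset.mem_filter.mp hS').2.2.2.1,
        e1, e2]
  refine h1.trans ?_
  rw [Finset.card_product, Finset.card_powersetCard, Finset.card_powersetCard, Finset.card_univ,
    Fintype.card_fin]
  exact Nat.mul_le_mul ((Nat.choose_le_pow _ _).trans (Nat.pow_le_pow_left hAm d))
    (Nat.choose_le_pow _ _)

theorem sum_norm_advCoeffDiff_sq_le {k : ℕ} {c : ℝ}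
    (hm : (m : ℝ) ^ (d + 2) * (n : ℝ) ^ (k - d - 1) ≤ c * n.choose k) (i : Fin n)
    (A : Finset (Fin n)) :
    ∑ S : {S : Finset (Fin n) // S.card = k}, ‖advCoeffDiff d m i S.1 A‖ ^ 2 ≤
      (1 + c) * n.choose k := by
  have hcard : Fintype.card {S : Finset (Fin n) // S.card = k} = n.choose k := by
    rw [Fintype.card_finset_len, Fintype.card_fin]
  refine (Finset.sum_le_sum fun S _ => norm_advCoeffDiff_sq_le i S.1 A).trans ?_
  rw [Finset.sum_add_distrib, ← Finset.sum_filter, Finset.sum_const, Finset.sum_const,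
    Finset.card_univ, hcard, nsmul_eq_mul, nsmul_eq_mul, mul_one, add_mul, one_mul]
  have h := card_crossing_le (m := m) (d := d) (k := k) i A
  have h' : ((Finset.univ.filter fun S : {S : Finset (Fin n) // S.card = k} =>
      i ∉ A ∧ A.card ≤ m ∧ i ∈ S.1 ∧ (A ∩ S.1).card = d).card : ℝ) ≤
      (m : ℝ) ^ d * (n : ℝ) ^ (k - d - 1) := by exact_mod_cast h
  have := mul_le_mul_of_nonneg_right h' (sq_nonneg (m : ℝ))
  have e : (m : ℝ) ^ d * (n : ℝ) ^ (k - d - 1) * (m : ℝ) ^ 2 =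
    (m : ℝ) ^ (d + 2) * (n : ℝ) ^ (k - d - 1) := by ring
  linarith

end Coefficients

/-! ### Low-degree functions restricted to orthogonal arrays -/

section RowSums

variable {X : Type u} [Fintype X] {n k d : ℕ} {T : Set (Fin k → X)}
  (S : {S : Finset (Fin n) // S.card = k})

open Classical in
/-- Restricting to an orthogonal array does not increase the norm of a combination of the
projections of low degree on its positions, up to normalization and a constant. -/
theorem IsOrthogonalArray.sum_norm_sq_le [Nonempty X] (hT : IsOrthogonalArray d k 1 T)
    (hdk : d < k) (β : Finset (Fin n) → ℂ) (hβ : ∀ A, d < (A ∩ S.1).card → β A = 0)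
    (b : (Fin n → X) → ℂ) :
    (Fintype.card X : ℝ) ^ (k - d) *
        ∑ x with proj x S ∈ T, ‖∑ A, β A * suppProj A b x‖ ^ 2 ≤
      2 ^ k * ∑ A, ‖β A‖ ^ 2 * ∑ x, ‖suppProj A b x‖ ^ 2 := by
  have hmaps : ∀ A ∈ (Finset.univ : Finset (Finset (Fin n))), A ∩ S.1 ∈ S.1.powerset :=
    fun A _ => Finset.mem_powerset.mpr Finset.inter_subset_right
  -- Cauchy–Schwarz over the 2 ^ k possible traces B = A ∩ S.
  have h1 : ∀ x, ‖∑ A, β A * suppProj A b x‖ ^ 2 ≤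
      2 ^ k * ∑ B ∈ S.1.powerset, ‖∑ A with A ∩ S.1 = B, β A * suppProj A b x‖ ^ 2 := by
    intro x
    rw [← Finset.sum_fiberwise_of_maps_to hmaps]
    refine (pow_le_pow_left₀ (norm_nonneg _) (norm_sum_le _ _) 2).trans
      (sq_sum_le_card_mul_sum_sq.trans_eq ?_)
    rw [Finset.card_powerset, S.2]
    push_cast
    rfl
  have h2 : ∀ B ∈ S.1.powerset, (Fintype.card X : ℝ) ^ (k - d) *
      ∑ x with proj x S ∈ T, ‖∑ A with A ∩ S.1 = B, β A * suppProj A b x‖ ^ 2 =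
      ∑ A with A ∩ S.1 = B, ‖β A‖ ^ 2 * ∑ x, ‖suppProj A b x‖ ^ 2 := by
    intro B hB
    rcases lt_or_ge d B.card with hlt | hle
    · have h0 : ∀ A ∈ Finset.univ.filter (fun A : Finset (Fin n) => A ∩ S.1 = B), β A = 0 :=
        fun A hA => hβ A (by rwa [(Finset.mem_filter.mp hA).2])
      have e1 : ∀ x, ∑ A with A ∩ S.1 = B, β A * suppProj A b x = 0 := fun x =>
        Finset.sum_eq_zero fun A hA => by rw [h0 A hA, zero_mul]
      rw [Finset.sum_eq_zero fun x _ => by rw [e1 x]; simp, mul_zero]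
      exact (Finset.sum_eq_zero fun A hA => by rw [h0 A hA]; simp).symm
    -- Sets A with trace B ⊆ D avoid S \ D, so their combined function is constant in those
    -- coordinates and averages over the array as over the whole cube.
    · obtain ⟨D, hBD, hDS, hD⟩ := Finset.exists_subsuperset_card_eq
        (Finset.mem_powerset.mp hB) hle (by rw [S.2]; exact hdk.le)
      rw [hT.sum_eq S hDS hD (fun x => ‖∑ A with A ∩ S.1 = B, β A * suppProj A b x‖ ^ 2),
        sum_norm_sq_sum_suppProj]
      intro x x' hx
      have : ∀ A ∈ Finset.univ.filter (fun A : Finset (Fin n) => A ∩ S.1 = B),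
          β A * suppProj A b x = β A * suppProj A b x' := by
        intro A hA
        rw [suppProj_congr b fun j hj => hx j fun hjD => ?_]
        have hj' := Finset.mem_sdiff.mp hjD
        have hjB : j ∈ B := by
          rw [← (Finset.mem_filter.mp hA).2]
          exact Finset.mem_inter.mpr ⟨hj, hj'.1⟩
        exact hj'.2 (hBD hjB)
      simp only [Finset.sum_congr rfl this]
  calc _ ≤ (Fintype.card X : ℝ) ^ (k - d) * ∑ x with proj x S ∈ T,
        2 ^ k * ∑ B ∈ S.1.powerset, ‖∑ A with A ∩ S.1 = B, β A * suppProj A b x‖ ^ 2 := by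
        gcongr with x _
        exact h1 x
    _ = 2 ^ k * ∑ B ∈ S.1.powerset, (Fintype.card X : ℝ) ^ (k - d) *
        ∑ x with proj x S ∈ T, ‖∑ A with A ∩ S.1 = B, β A * suppProj A b x‖ ^ 2 := by
        rw [← Finset.mul_sum, Finset.sum_comm, ← Finset.mul_sum]
        ring
    _ = _ := by
        rw [Finset.sum_congr rfl h2, Finset.sum_fiberwise_of_maps_to hmaps]

open Classical in
-- Below the cutoff the array sums are scaled sums over the whole cube, which vanish unless A = ∅.
theorem IsOrthogonalArray.sum_advCoeff_mul [Nonempty X] (hT : IsOrthogonalArray d k 1 T)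
    (hdk : d < k) (m : ℕ) (y : Fin n → X) :
    (Fintype.card X : ℂ) ^ (k - d) *
      ∑ x with proj x S ∈ T, ∑ A, advCoeff d m S.1 A * suppKernel A x y = m := by
  have h : ∀ A, advCoeff d m S.1 A * ((Fintype.card X : ℂ) ^ (k - d) *
      ∑ x with proj x S ∈ T, suppKernel A x y) = if A = ∅ then (m : ℂ) else 0 := by
    intro A
    rcases lt_or_ge d (A ∩ S.1).card with hlt | hle
    · rw [advCoeff_of_lt hlt, zero_mul, if_neg]
      rintro rfl
      simp at hlt
    · obtain ⟨D, hBD, hDS, hD⟩ := Finset.exists_subsuperset_card_eq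
        (Finset.inter_subset_right : A ∩ S.1 ⊆ S.1) hle (by rw [S.2]; exact hdk.le)
      rw [hT.sum_eq S hDS hD (fun x => suppKernel A x y), sum_suppKernel]
      · split_ifs with hA
        · simp [hA, advCoeff]
        · rw [mul_zero]
      · intro x x' hx
        refine suppKernel_congr y fun j hj => hx j fun hjD => ?_
        have hj' := Finset.mem_sdiff.mp hjD
        exact hj'.2 (hBD (Finset.mem_inter.mpr ⟨hj, hj'.1⟩))
  rw [Finset.sum_comm, Finset.mul_sum]
  refine (Finset.sum_congr rfl fun A _ => ?_).trans
    ((Finset.sum_ite_eq' Finset.univ ∅ fun _ => (m : ℂ)).trans (if_pos (Finset.mem_univ _)))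
  rw [← h A, ← Finset.mul_sum, mul_left_comm]

open Classical in
theorem IsOrthogonalArray.card_filter_eq (hT : IsOrthogonalArray d k 1 T) (hdk : d < k) :
    Fintype.card X ^ (k - d) * (Finset.univ.filter fun x : Fin n → X => proj x S ∈ T).card =
      Fintype.card X ^ n := by
  obtain ⟨D, -, hDS, hD⟩ := Finset.exists_subsuperset_card_eq
    (Finset.empty_subset S.1) (Nat.zero_le d) (by rw [S.2]; exact hdk.le)
  have h := hT.sum_eq S hDS hD (fun _ => (1 : ℕ)) fun _ _ _ => rfl
  simpa using h

end RowSums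

theorem orthogonalArrayProblem_eq_true {X : Type u} {n k : ℕ}
    {T : {S : Finset (Fin n) // S.card = k} → Set (Fin k → X)} {x : Fin n → X} :
    orthogonalArrayProblem T x = true ↔ ∃ S, proj x S ∈ T S := by
  simp [orthogonalArrayProblem]

/-! ### Norm estimates for the adversary matrix -/

section LowerBound

variable {X : Type u} [Fintype X] {n k d : ℕ}
  {T : {S : Finset (Fin n) // S.card = k} → Set (Fin k → X)}

open Classical in
theorem sum_positive {M : Type*} [AddCommMonoid M]
    (g : {S : Finset (Fin n) // S.card = k} → (Fin n → X) → M) :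
    ∑ r : (Σ S, {x : Fin n → X // proj x S ∈ T S}), g r.1 r.2.1 =
      ∑ S, ∑ x with proj x S ∈ T S, g S x := by
  rw [Fintype.sum_sigma]
  refine Finset.sum_congr rfl fun S _ => ?_
  exact (Finset.sum_subtype (p := fun x => proj x S ∈ T S) _ (by simp) (g S)).symm

open Classical in
theorem card_le_of_computes [Nonempty X] (hdk : d < k) (hkn : k ≤ n)
    (hT : ∀ S, IsOrthogonalArray d k 1 (T S))
    (hneg : Fintype.card X ^ n ≤
      9 * Fintype.card {x : Fin n → X // orthogonalArrayProblem T x = false})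
    {m : ℕ} (hm0 : 0 < m) {c : ℝ} (hc : 0 ≤ c)
    (hm : (m : ℝ) ^ (d + 2) * (n : ℝ) ^ (k - d - 1) ≤ c * n.choose k)
    (A : QueryAlgorithm n X) (hA : A.Computes (orthogonalArrayProblem T)) :
    (m : ℝ) ≤ 216 * √(2 ^ k * (1 + c)) * A.queries := by
  set q : ℝ := (Fintype.card X : ℝ) with hq
  have hq0 : 0 < q := Nat.cast_pos.mpr Fintype.card_pos
  set N : ℝ := (n.choose k : ℝ) with hN
  have hN0 : 0 < N := Nat.cast_pos.mpr (Nat.choose_pos hkn)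
  set Q : ℝ := q ^ (k - d) with hQ
  have hQ0 : 0 < Q := by positivity
  have hm0' : (0 : ℝ) < m := Nat.cast_pos.mpr hm0
  have hcardS : Fintype.card {S : Finset (Fin n) // S.card = k} = n.choose k := by
    rw [Fintype.card_finset_len, Fintype.card_fin]
  -- A positive input occurs once for every S that certifies it; the adversary bound allows repeated
  -- rows.
  let R := Σ S, {x : Fin n → X // proj x S ∈ T S}
  let C := {x : Fin n → X // orthogonalArrayProblem T x = false}
  let M : R → C → ℂ := fun r y => ∑ A, advCoeff d m r.1.1 A * suppKernel A r.2.1 y.1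
  let M' : Fin n → R → C → ℂ := fun i r y =>
    ∑ A, advCoeffDiff d m i r.1.1 A * suppKernel A r.2.1 y.1
  have hMM' : ∀ i (r : R) (y : C), r.2.1 i ≠ y.1 i → M' i r y = M r y := by
    intro i r y hxy
    simp only [M, M']
    rw [sum_insert_eq (fun A => advCoeff d m r.1.1 A * suppKernel A r.2.1 y.1) i]
    refine Finset.sum_congr rfl fun A _ => ?_
    rw [advCoeffDiff]
    split_ifs with hi
    · rw [zero_mul]
    · rw [suppKernel_insert hi hxy]
      ring
  have hM' : ∀ i, ∀ b : C → ℂ, ∑ r, ‖∑ y, M' i r y * b y‖ ^ 2 ≤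
      √(2 ^ k * (1 + c) * (N / Q)) ^ 2 * ∑ y, ‖b y‖ ^ 2 := by
    intro i b
    rw [Real.sq_sqrt (by positivity)]
    -- Extension by zero to all inputs, where the projections are orthogonal and Parseval holds.
    let b' : (Fin n → X) → ℂ := fun y =>
      if h : orthogonalArrayProblem T y = false then b ⟨y, h⟩ else 0
    have hb' : ∀ {E : Type} [AddCommMonoid E] (g : (Fin n → X) → ℂ → E), (∀ y, g y 0 = 0) →
        ∑ y, g y (b' y) = ∑ y : C, g y.1 (b y) := by
      intro E _ g hg
      have h1 : ∑ y, g y (b' y) =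
          ∑ y with orthogonalArrayProblem T y = false, g y (b' y) := by
        rw [Finset.sum_filter]
        refine Finset.sum_congr rfl fun y _ => ?_
        split_ifs with h
        · rfl
        · simp only [b', dif_neg h, hg]
      rw [h1, Finset.sum_subtype (p := fun y => orthogonalArrayProblem T y = false) _ (by simp)]
      refine Finset.sum_congr rfl fun y _ => ?_
      simp only [b', dif_pos y.2]
    have hrow : ∀ r : R, ∑ y, M' i r y * b y =
        ∑ A, advCoeffDiff d m i r.1.1 A * suppProj A b' r.2.1 := by
      intro r
      rw [← hb' (fun y z => (∑ A, advCoeffDiff d m i r.1.1 A * suppKernel A r.2.1 y) * z)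
        (fun y => mul_zero _)]
      simp only [suppProj, Finset.sum_mul, Finset.mul_sum]
      rw [Finset.sum_comm]
      exact Finset.sum_congr rfl fun _ _ => Finset.sum_congr rfl fun _ _ => by ring
    have hnorm : ∑ y, ‖b y‖ ^ 2 = ∑ A, ∑ x, ‖suppProj A b' x‖ ^ 2 := by
      rw [sum_norm_sq_suppProj, hb' (fun _ z => ‖z‖ ^ 2) (by simp)]
    simp only [hrow]
    rw [sum_positive (fun S x => ‖∑ A, advCoeffDiff d m i S.1 A * suppProj A b' x‖ ^ 2), hnorm]
    have h1 : Q * ∑ S, ∑ x with proj x S ∈ T S,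
        ‖∑ A, advCoeffDiff d m i S.1 A * suppProj A b' x‖ ^ 2 ≤
        2 ^ k * ((1 + c) * N * ∑ A, ∑ x, ‖suppProj A b' x‖ ^ 2) := by
      rw [Finset.mul_sum]
      calc _ ≤ ∑ S : {S : Finset (Fin n) // S.card = k},
            2 ^ k * ∑ A, ‖advCoeffDiff d m i S.1 A‖ ^ 2 * ∑ x, ‖suppProj A b' x‖ ^ 2 :=
            Finset.sum_le_sum fun S _ => (hT S).sum_norm_sq_le S hdk _
              (fun A hA => advCoeffDiff_of_lt i hA) b'
        _ = 2 ^ k * ∑ A, (∑ S : {S : Finset (Fin n) // S.card = k},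
            ‖advCoeffDiff d m i S.1 A‖ ^ 2) * ∑ x, ‖suppProj A b' x‖ ^ 2 := by
            rw [← Finset.mul_sum, Finset.sum_comm]
            simp only [Finset.sum_mul]
        _ ≤ _ := by
            refine mul_le_mul_of_nonneg_left ?_ (by positivity)
            rw [Finset.mul_sum]
            exact Finset.sum_le_sum fun A _ => mul_le_mul_of_nonneg_right
              (sum_norm_advCoeffDiff_sq_le hm i A) (by positivity)
    rw [mul_comm Q, ← le_div_iff₀ hQ0] at h1
    refine h1.trans_eq ?_
    field_simp
  have hv : ∑ y : C, ‖(1 : ℂ)‖ ^ 2 = (Fintype.card C : ℝ) := by simp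
  have hneg' : q ^ n ≤ 9 * (Fintype.card C : ℝ) := by
    rw [hq]
    exact_mod_cast hneg
  have hC0 : (0 : ℝ) < Fintype.card C := by
    have : 0 < q ^ n := by positivity
    linarith
  have hL : (m / 3 * √(N / Q)) ^ 2 * ∑ y : C, ‖(1 : ℂ)‖ ^ 2 ≤
      ∑ r, ‖∑ y, M r y * (1 : ℂ)‖ ^ 2 := by
    rw [hv, mul_pow, Real.sq_sqrt (by positivity)]
    have hQC : (Fintype.card X : ℂ) ^ (k - d) ≠ 0 :=
      pow_ne_zero _ (Nat.cast_ne_zero.mpr Fintype.card_ne_zero)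
    have htot : ∑ r, ∑ y, M r y * (1 : ℂ) = ((N * (m / Q) * Fintype.card C : ℝ) : ℂ) := by
      rw [Finset.sum_comm]
      have h1 : ∀ y : C, ∑ r, M r y * (1 : ℂ) = ((N * (m / Q) : ℝ) : ℂ) := by
        intro y
        simp only [mul_one, M]
        rw [sum_positive (fun S x => ∑ A, advCoeff d m S.1 A * suppKernel A x y.1)]
        have h2 : ∀ S : {S : Finset (Fin n) // S.card = k}, ∑ x with proj x S ∈ T S,
            ∑ A, advCoeff d m S.1 A * suppKernel A x y.1 =
              (m : ℂ) / (Fintype.card X : ℂ) ^ (k - d) := by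
          intro S
          rw [eq_div_iff hQC, mul_comm]
          exact (hT S).sum_advCoeff_mul S hdk m y.1
        rw [Finset.sum_congr rfl fun S _ => h2 S, Finset.sum_const, Finset.card_univ, hcardS,
          nsmul_eq_mul]
        simp [hN, hQ, hq]
      rw [Finset.sum_congr rfl fun y _ => h1 y, Finset.sum_const, Finset.card_univ, nsmul_eq_mul]
      push_cast
      ring
    have hcardR : (Fintype.card R : ℝ) * Q = N * q ^ n := by
      have h1 : Fintype.card R = ∑ S : {S : Finset (Fin n) // S.card = k},
          (Finset.univ.filter fun x : Fin n → X => proj x S ∈ T S).card := by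
        rw [Fintype.card_sigma]
        exact Finset.sum_congr rfl fun S _ => Fintype.card_subtype _
      have h2 : Fintype.card X ^ (k - d) * Fintype.card R =
          n.choose k * Fintype.card X ^ n := by
        rw [h1, Finset.mul_sum, Finset.sum_congr rfl fun S _ => (hT S).card_filter_eq S hdk,
          Finset.sum_const, Finset.card_univ, hcardS, smul_eq_mul]
      rw [mul_comm, hQ, hN, hq]
      exact_mod_cast h2
    -- Cauchy–Schwarz over the rows reduces the norm of the image of the all-ones vector to the
    -- total of the entries.
    have hCS : (N * (m / Q) * Fintype.card C) ^ 2 ≤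
        Fintype.card R * ∑ r, ‖∑ y, M r y * (1 : ℂ)‖ ^ 2 := by
      have h1 : N * (m / Q) * Fintype.card C ≤ ∑ r, ‖∑ y, M r y * (1 : ℂ)‖ := by
        refine le_trans ?_ (norm_sum_le _ _)
        rw [htot, Complex.norm_real]
        exact le_abs_self _
      refine (pow_le_pow_left₀ (by positivity) h1 2).trans ?_
      exact sq_sum_le_card_mul_sum_sq
    have hR0 : (0 : ℝ) < Fintype.card R := by
      have : 0 < N * q ^ n := by positivity
      rw [← hcardR] at this
      exact pos_of_mul_pos_left this hQ0.le
    refine le_of_mul_le_mul_left (le_trans ?_ hCS) hR0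
    have hR : (Fintype.card R : ℝ) = N * q ^ n / Q := by
      rw [eq_div_iff hQ0.ne', hcardR]
    rw [hR]
    have : (N * (m / Q) * Fintype.card C) ^ 2 - N * q ^ n / Q *
        ((m / 3) ^ 2 * (N / Q) * Fintype.card C) =
        (N * m / Q) ^ 2 / 9 * Fintype.card C * (9 * Fintype.card C - q ^ n) := by
      field_simp
      ring
    have h0 : 0 ≤ (N * m / Q) ^ 2 / 9 * Fintype.card C * (9 * Fintype.card C - q ^ n) :=
      mul_nonneg (by positivity) (by linarith)
    linarith
  have hfin := A.adversary_bound hA (fun r : R => r.2.1) (fun y : C => y.1)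
    (fun r => orthogonalArrayProblem_eq_true.mpr ⟨r.1, r.2.2⟩) (fun y => y.2) M M' hMM'
    (K := √(2 ^ k * (1 + c) * (N / Q))) (L := m / 3 * √(N / Q))
    (Real.sqrt_pos.mpr (by positivity)) (mul_pos (by positivity) (Real.sqrt_pos.mpr (by positivity)))
    hM' (fun _ => 1) hL (by rw [hv]; exact hC0.ne')
  rw [Real.sqrt_mul (by positivity) (N / Q)] at hfin
  have hs : 0 < √(N / Q) := Real.sqrt_pos.mpr (by positivity)
  have : (m : ℝ) / 3 ≤ 72 * √(2 ^ k * (1 + c)) * A.queries := by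
    refine le_of_mul_le_mul_right (hfin.trans_eq ?_) hs
    ring
  linarith

/-! ### Negative inputs -/

open Classical in
-- Union bound over S: the positive fraction is at most n.choose k / q ^ (k - d) ≤ 1 / k! ≤ 1/2.
theorem card_negative_of_two_le (hdk : d < k) (hk : 2 ≤ k)
    (hT : ∀ S, IsOrthogonalArray d k 1 (T S)) (hX : n ^ k ≤ Fintype.card X ^ (k - d)) :
    Fintype.card X ^ n ≤
      9 * Fintype.card {x : Fin n → X // orthogonalArrayProblem T x = false} := by
  set q := Fintype.card X with hq
  set P := (Finset.univ.filter fun x : Fin n → X => orthogonalArrayProblem T x = true).card with hP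
  have hcompl : P + Fintype.card {x : Fin n → X // orthogonalArrayProblem T x = false} = q ^ n := by
    rw [Fintype.card_subtype, hP]
    have h := Finset.card_filter_add_card_filter_not (s := (Finset.univ : Finset (Fin n → X)))
      (fun x => orthogonalArrayProblem T x = true)
    simp only [Bool.not_eq_true] at h
    rw [h, Finset.card_univ, Fintype.card_fun, Fintype.card_fin]
  -- An empty alphabet forces n = 0, and then no k-element S exists.
  rcases Nat.eq_zero_or_pos (q ^ (k - d)) with h0 | h0
  · have hn : n = 0 := by
      by_contra hn
      have : 0 < n ^ k := pow_pos (Nat.pos_of_ne_zero hn) k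
      omega
    subst hn
    have : P = 0 := by
      rw [hP, Finset.card_eq_zero]
      refine Finset.filter_false_of_mem fun x _ hx => ?_
      obtain ⟨S, -⟩ := orthogonalArrayProblem_eq_true.mp hx
      have := S.2
      rw [Finset.eq_empty_of_isEmpty S.1, Finset.card_empty] at this
      omega
    omega
  have hPle : P ≤ ∑ S : {S : Finset (Fin n) // S.card = k},
      (Finset.univ.filter fun x : Fin n → X => proj x S ∈ T S).card := by
    refine (Finset.card_le_card fun x hx => ?_).trans Finset.card_biUnion_le
    obtain ⟨S, hS⟩ := orthogonalArrayProblem_eq_true.mp (Finset.mem_filter.mp hx).2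
    exact Finset.mem_biUnion.mpr ⟨S, Finset.mem_univ _, by simpa using hS⟩
  have hPq : q ^ (k - d) * P ≤ n.choose k * q ^ n := by
    refine (Nat.mul_le_mul_left _ hPle).trans_eq ?_
    rw [Finset.mul_sum, Finset.sum_congr rfl fun S _ => (hT S).card_filter_eq S hdk,
      Finset.sum_const, Finset.card_univ, Fintype.card_finset_len, Fintype.card_fin, smul_eq_mul]
  have hch : 2 * n.choose k ≤ n ^ k := by
    have h1 : k.factorial * n.choose k ≤ n ^ k := by
      rw [← Nat.descFactorial_eq_factorial_mul_choose]
      exact Nat.descFactorial_le_pow n k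
    have h2 : 2 ≤ k.factorial := Nat.factorial_le hk
    exact (Nat.mul_le_mul_right _ h2).trans h1
  have h2P : 2 * P ≤ q ^ n := by
    refine Nat.le_of_mul_le_mul_left ?_ h0
    calc q ^ (k - d) * (2 * P) = 2 * (q ^ (k - d) * P) := by ring
      _ ≤ 2 * (n.choose k * q ^ n) := Nat.mul_le_mul_left _ hPq
      _ = 2 * n.choose k * q ^ n := by ring
      _ ≤ q ^ (k - d) * q ^ n := Nat.mul_le_mul_right _ (hch.trans hX)
  omega

/-- (q / (q - 1)) ^ n ≤ exp (n / (q - 1)) ≤ exp 2 < 9, since n ≤ q ≤ 2 (q - 1). -/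
theorem pow_le_nine_mul_sub_one_pow {n q : ℕ} (hn : 2 ≤ n) (hq : n ≤ q) :
    q ^ n ≤ 9 * (q - 1) ^ n := by
  have hq1 : (1 : ℝ) ≤ (q : ℝ) - 1 := by
    have : (2 : ℝ) ≤ q := by exact_mod_cast hn.trans hq
    linarith
  have hcast : ((q - 1 : ℕ) : ℝ) = (q : ℝ) - 1 := by
    rw [Nat.cast_sub (by omega), Nat.cast_one]
  have h1 : (q : ℝ) = (1 / ((q : ℝ) - 1) + 1) * ((q : ℝ) - 1) := by
    field_simp
    ring
  have h2 : (1 / ((q : ℝ) - 1) + 1) ^ n ≤ 9 := by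
    calc (1 / ((q : ℝ) - 1) + 1) ^ n ≤ Real.exp (1 / ((q : ℝ) - 1)) ^ n :=
          pow_le_pow_left₀ (by positivity) (Real.add_one_le_exp _) n
      _ = Real.exp (n * (1 / ((q : ℝ) - 1))) := (Real.exp_nat_mul _ _).symm
      _ ≤ Real.exp 2 := by
          apply Real.exp_le_exp.mpr
          rw [mul_one_div, div_le_iff₀ (by linarith)]
          have : (n : ℝ) ≤ q := by exact_mod_cast hq
          linarith
      _ ≤ 9 := by
          have h3 : Real.exp 2 = Real.exp 1 ^ 2 := by
            rw [← Real.exp_nat_mul]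
            norm_num
          rw [h3]
          have := Real.exp_one_lt_d9
          nlinarith [Real.exp_pos 1]
  have h3 : (q : ℝ) ^ n ≤ 9 * ((q : ℝ) - 1) ^ n := by
    conv_lhs => rw [h1, mul_pow]
    exact mul_le_mul_of_nonneg_right h2 (by positivity)
  rw [← hcast] at h3
  exact_mod_cast h3

open Classical in
-- For k = 1 the union bound is void when q = n. Each position forbids one symbol, so at least (q -
-- 1) ^ n inputs are negative.
theorem card_negative_of_eq_one (hk : k = 1) (hd : d = 0) (hn : 2 ≤ n)
    (hT : ∀ S, IsOrthogonalArray d k 1 (T S)) (hX : n ≤ Fintype.card X) :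
    Fintype.card X ^ n ≤
      9 * Fintype.card {x : Fin n → X // orthogonalArrayProblem T x = false} := by
  subst hk hd
  have hsing : ∀ i : Fin n, ∃ a : X, ∀ w ∈ T ⟨{i}, Finset.card_singleton i⟩, w 0 = a := by
    intro i
    have h := (hT ⟨{i}, Finset.card_singleton i⟩).card_eq
    rw [pow_zero, mul_one] at h
    obtain ⟨w, hw⟩ := Set.ncard_eq_one.mp h
    exact ⟨w 0, fun w' hw' => by rw [hw] at hw'; rw [hw']⟩
  choose a ha using hsing
  refine (pow_le_nine_mul_sub_one_pow hn hX).trans (Nat.mul_le_mul_left 9 ?_)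
  have h1 : (Fintype.card X - 1) ^ n =
      (Fintype.piFinset fun i => Finset.univ.erase (a i)).card := by
    simp [Fintype.card_piFinset, Finset.card_erase_of_mem]
  rw [h1, Fintype.card_subtype]
  refine Finset.card_le_card fun x hx => Finset.mem_filter.mpr ⟨Finset.mem_univ _, ?_⟩
  rw [← Bool.not_eq_true, orthogonalArrayProblem_eq_true]
  rintro ⟨⟨S, hS⟩, hxS⟩
  obtain ⟨i, rfl⟩ := Finset.card_eq_one.mp hS
  have h2 := ha i _ hxS
  have h3 : proj x ⟨{i}, hS⟩ 0 = x i := by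
    have : ({i} : Finset (Fin n)).orderEmbOfFin hS 0 = i :=
      Finset.mem_singleton.mp (Finset.orderEmbOfFin_mem _ hS 0)
    simp only [proj, this]
  rw [h3] at h2
  exact Finset.ne_of_mem_erase (Fintype.mem_piFinset.mp hx i) h2

end LowerBound

/-! ### Choice of parameters and conclusion -/

theorem pow_le_mul_choose {n k : ℕ} (h : 2 * k ≤ n) :
    (n : ℝ) ^ k ≤ 2 ^ k * k.factorial * n.choose k := by
  have h1 : ((n + 1 - k : ℕ) : ℝ) ^ k ≤ k.factorial * n.choose k := by
    have := Nat.pow_sub_le_descFactorial n k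
    rw [Nat.descFactorial_eq_factorial_mul_choose] at this
    exact_mod_cast this
  have h2 : (n : ℝ) ≤ 2 * ((n + 1 - k : ℕ) : ℝ) := by
    have : n ≤ 2 * (n + 1 - k) := by omega
    exact_mod_cast this
  calc (n : ℝ) ^ k ≤ (2 * ((n + 1 - k : ℕ) : ℝ)) ^ k := pow_le_pow_left₀ (by positivity) h2 k
    _ = 2 ^ k * ((n + 1 - k : ℕ) : ℝ) ^ k := mul_pow _ _ _
    _ ≤ 2 ^ k * (k.factorial * n.choose k) := by gcongr
    _ = _ := by ring

theorem mainTheorem1 (k d : ℕ) (hd : d < k) :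
    ∃ c : ℝ, 0 < c ∧ ∃ n₀ : ℕ, ∀ n : ℕ, n₀ ≤ n →
      ∀ (X : Type u) [Fintype X],
        (n : ℝ) ^ ((k : ℝ) / ((k : ℝ) - (d : ℝ))) ≤ (Fintype.card X : ℝ) →
        ∀ T : {S : Finset (Fin n) // S.card = k} → Set (Fin k → X),
          (∀ S, IsOrthogonalArray d k 1 (T S)) →
          ENNReal.ofReal (c * (n : ℝ) ^ (((d : ℝ) + 1) / ((d : ℝ) + 2))) ≤
            ((quantumQueryComplexity (orthogonalArrayProblem T) : ℕ∞) : ENNReal) := by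
  set B : ℝ := 216 * √(2 ^ k * (1 + 2 ^ k * k.factorial)) with hB
  have hB0 : 0 < B := mul_pos (by norm_num) (Real.sqrt_pos.mpr (by positivity))
  -- The 2 absorbs the rounding of m. The threshold 2k gives n ≥ 2 and n ^ k ≤ 2 ^ k * k! * n.choose
  -- k, the source of the constant in B.
  refine ⟨(2 * B)⁻¹, by positivity, 2 * k, fun n hn X _ hX T hT => ?_⟩
  have hn2 : 2 ≤ n := by omega
  have hn1 : (1 : ℝ) ≤ n := by exact_mod_cast (by omega : 1 ≤ n)
  set e : ℝ := ((d : ℝ) + 1) / ((d : ℝ) + 2) with he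
  have he0 : 0 ≤ e := by positivity
  have hne : 1 ≤ (n : ℝ) ^ e := Real.one_le_rpow hn1 he0
  -- The largest m with m ^ (d + 2) ≤ n ^ (d + 1), which balances the crossing terms against N.
  set m : ℕ := ⌊(n : ℝ) ^ e⌋₊ with hm
  have hm1 : 1 ≤ m := Nat.le_floor (by rwa [Nat.cast_one])
  have hmle : (m : ℝ) ≤ (n : ℝ) ^ e := Nat.floor_le (by positivity)
  have hmge : (n : ℝ) ^ e ≤ 2 * m := by
    have h1 := (Nat.lt_floor_add_one ((n : ℝ) ^ e)).le
    have h2 : (1 : ℝ) ≤ m := by exact_mod_cast hm1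
    rw [← hm] at h1
    linarith
  have hXpow : n ^ k ≤ Fintype.card X ^ (k - d) := by
    have h1 := pow_le_pow_left₀ (by positivity) hX (k - d)
    have hkd : (k : ℝ) - d = ((k - d : ℕ) : ℝ) := by rw [Nat.cast_sub hd.le]
    have hkd0 : ((k - d : ℕ) : ℝ) ≠ 0 := Nat.cast_ne_zero.mpr (by omega)
    rw [← Real.rpow_natCast, ← Real.rpow_mul (by positivity), hkd, div_mul_cancel₀ _ hkd0,
      Real.rpow_natCast] at h1
    exact_mod_cast h1
  have hX0 : 0 < Fintype.card X := by
    rcases Nat.eq_zero_or_pos (Fintype.card X) with h | h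
    · rw [h, zero_pow (by omega)] at hXpow
      have : 0 < n ^ k := pow_pos (by omega) k
      omega
    · exact h
  have : Nonempty X := Fintype.card_pos_iff.mp hX0
  classical
  have hneg : Fintype.card X ^ n ≤
      9 * Fintype.card {x : Fin n → X // orthogonalArrayProblem T x = false} := by
    rcases Nat.lt_or_ge k 2 with hk | hk
    · have hk1 : k = 1 := by omega
      have hd0 : d = 0 := by omega
      refine card_negative_of_eq_one hk1 hd0 hn2 hT ?_
      simpa [hk1, hd0] using hXpow
    · exact card_negative_of_two_le hd hk hT hXpow
  have hmpow : (m : ℝ) ^ (d + 2) * (n : ℝ) ^ (k - d - 1) ≤ 2 ^ k * k.factorial * n.choose k := by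
    have h1 : (m : ℝ) ^ (d + 2) ≤ (n : ℝ) ^ (d + 1) := by
      refine (pow_le_pow_left₀ (by positivity) hmle (d + 2)).trans_eq ?_
      rw [← Real.rpow_natCast, ← Real.rpow_mul (by positivity), ← Real.rpow_natCast (n : ℝ)]
      congr 1
      rw [he]
      push_cast
      field_simp
    refine (mul_le_mul_of_nonneg_right h1 (by positivity)).trans ?_
    rw [← pow_add, show d + 1 + (k - d - 1) = k by omega]
    exact pow_le_mul_choose hn
  have key : ∀ A : QueryAlgorithm n X, A.Computes (orthogonalArrayProblem T) →
      (2 * B)⁻¹ * (n : ℝ) ^ e ≤ A.queries := by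
    intro A hA
    have h := card_le_of_computes hd (by omega) hT (by convert hneg) hm1 (by positivity) hmpow A hA
    rw [← hB] at h
    rw [inv_mul_le_iff₀ (by positivity)]
    linarith
  have hceil : ((⌈(2 * B)⁻¹ * (n : ℝ) ^ e⌉₊ : ℕ) : ℕ∞) ≤
      quantumQueryComplexity (orthogonalArrayProblem T) :=
    le_iInf₂ fun A hA => by exact_mod_cast Nat.ceil_le.mpr (key A hA)
  refine le_trans ?_ (ENat.toENNReal_le.mpr hceil)
  rw [ENat.toENNReal_coe]
  exact ENNReal.ofReal_le_of_le_toReal (by simpa using Nat.le_ceil _)
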